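/- Let $\mathbb F_4=\{0,1,\alpha,\alpha^2=\alpha+1\}$, let $R=\mathrm{GR}(4,2)=\mathbb Z_4[x]/(x^2+x+1)$, let $\xi$ be the class of $x$ in $R$, and let $\pi:R\to R/2R\cong\mathbb F_4$ be the natural epimorphism. The restriction of $\pi$ to the Teichmüller system $\mathcal T=\{0,1,\xi,\xi^2\}$ is a bijection onto $\mathbb F_4$; write $\pi^{-1}:\mathbb F_4\to\mathcal T$ for its inverse. Let $k,j,\ell$ be integers with $1\le k\le j\le \ell$. Define the quadratic form $$Q_{\ell,j}(x_1,\dots,x_{2\ell})=\sum_{i=1}^{j}\left(\alpha x_{2i-1}^2+x_{2i-1}x_{2i}+x_{2i}^2\right)+\sum_{i=j+1}^{\ell}x_{2i-1}x_{2i}$$ on $\mathbb F_4^{2\ell}$, the bijection $F_k:\mathbb F_4^{2\ell}\to R^k\times\mathbb F_4^{2\ell-2k}$ by $$F_k(x_1,\dots,x_{2\ell})=\left(\pi^{-1}(x_1)+2\pi^{-1}(x_2),\dots,\pi^{-1}(x_{2k-1})+2\pi^{-1}(x_{2k}),x_{2k+1},\dots,x_{2\ell}\right),$$ and the set $$D_{\ell,j,k}=\{F_k(x)\mid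 x\in\mathbb F_4^{2\ell}\setminus\{0\},\ Q_{\ell,j}(x)=0\}.$$ A subset $D$ of a finite abelian group $G$, written additively, is a $(v,\kappa,\lambda,\mu)$-partial difference set (PDS), with integer parameters, if $|G|=v$, $|D|=\kappa$, and the multiset $\{d_1-d_2\mid d_1,d_2\in D,\ d_1\ne d_2\}$ contains each nonzero element of $D$ exactly $\lambda$ times and each nonzero element of $G\setminus D$ exactly $\mu$ times. For $\epsilon=1$ (respectively $\epsilon=-1$) it is of Latin square type (respectively negative Latin square type) if $(v,\kappa,\lambda,\mu)=(n^2,\,r(n-\epsilon),\,\epsilon n+r^2-3\epsilon r,\,r^2-\epsilon r)$ for some integers $n,r\ge 0$. **Theorem.** The additive group of $R^k\times\mathbb F_4^{2\ell-2k}$ is isomorphic to $\mathbb Z_4^{2k}\times\mathbb Z_2^{4\ell-4k}$. In this group (equivalently, after transport along any isomorphism, in $\mathbb Z_4^{2k}\times\mathbb Z_2^{4\ell-4k}$): - if $j$ is odd, $D_{\ell,j,k}$ is a negative Latin square type PDS with parameters $$\left(4^{2\ell},\ (4^\ell+1)(4^{\ell-1}-1),\ 4^{2\ell-2}-3\cdot4^{\ell-1}-2,\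 4^{2\ell-2}-4^{\ell-1}\right);$$ - if $j$ is even, $D_{\ell,j,k}$ is a Latin square type PDS with parameters $$\left(4^{2\ell},\ (4^\ell-1)(4^{\ell-1}+1),\ 4^{2\ell-2}+3\cdot4^{\ell-1}-2,\ 4^{2\ell-2}+4^{\ell-1}\right).$$ -/

import Mathlib

open Polynomial

noncomputable section

namespace GaloisRingPDS

/-! ### Partial difference sets -/

/-- A subset `D` of a finite (additively written) group `G` is a
`(v, κ, lam, mu)`-partial difference set: `|G| = v`, `|D| = κ`, and in the multiset of differences
`d₁ - d₂` of distinct elements of `D`, each nonzero element of `D` occurs exactly `lam` times and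
each nonzero element outside `D` occurs exactly `mu` times. -/
structure IsPDS {G : Type*} [AddGroup G] (D : Set G) (v κ lam mu : ℤ) : Prop where
  finite : Finite G
  card_group : (Nat.card G : ℤ) = v
  card_set : (D.ncard : ℤ) = κ
  count_mem : ∀ g : G, g ≠ 0 → g ∈ D →
    ({p : G × G | p.1 ∈ D ∧ p.2 ∈ D ∧ p.1 ≠ p.2 ∧ p.1 - p.2 = g}.ncard : ℤ) = lam
  count_not_mem : ∀ g : G, g ≠ 0 → g ∉ D →
    ({p : G × G | p.1 ∈ D ∧ p.2 ∈ D ∧ p.1 ≠ p.2 ∧ p.1 - p.2 = g}.ncard : ℤ) = mu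

/-- The quadruple has the shape `(n², r(n - ε), εn + r² - 3εr, r² - εr)` with `n, r` natural
numbers. -/
def IsLatinSquareShape (ε v κ lam mu : ℤ) : Prop :=
  ∃ n r : ℕ, v = (n : ℤ) ^ 2 ∧ κ = r * (n - ε) ∧
    lam = ε * n + (r : ℤ) ^ 2 - 3 * ε * r ∧ mu = (r : ℤ) ^ 2 - ε * r

/-- A Latin square type partial difference set (`ε = 1`). -/
def IsLatinSquareTypePDS {G : Type*} [AddGroup G] (D : Set G) (v κ lam mu : ℤ) : Prop :=
  IsPDS D v κ lam mu ∧ IsLatinSquareShape 1 v κ lam mu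

/-- A negative Latin square type partial difference set (`ε = -1`). -/
def IsNegativeLatinSquareTypePDS {G : Type*} [AddGroup G] (D : Set G) (v κ lam mu : ℤ) : Prop :=
  IsPDS D v κ lam mu ∧ IsLatinSquareShape (-1) v κ lam mu

/-! ### The field, the Galois ring and the Teichmüller system -/

/-- The field with four elements. -/
abbrev F4 : Type := GaloisField 2 2

/-- The Galois ring `GR(4,2) = ℤ₄[x] / (x² + x + 1)`. -/
abbrev GR42 : Type := AdjoinRoot (X ^ 2 + X + 1 : (ZMod 4)[X])

/-- The class of `x` in `GR(4,2)`. -/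
def xi : GR42 := AdjoinRoot.root (X ^ 2 + X + 1 : (ZMod 4)[X])

/-- The Teichmüller system `{0, 1, ξ, ξ²}`. -/
def teichmullerSet : Set GR42 := {0, 1, xi, xi ^ 2}

/-- The inverse of the restriction of the reduction map `π` to the Teichmüller system; see
`bijOn_teichmullerSet`. -/
def teichmullerLift (π : GR42 →+* F4) : F4 → GR42 :=
  Function.invFunOn π teichmullerSet

theorem xi_relation : xi ^ 2 + xi + 1 = 0 := by
  have h := AdjoinRoot.eval₂_root (X ^ 2 + X + 1 : (ZMod 4)[X])
  simpa [xi] using h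

/-- The reduction map restricts to a bijection from the Teichmüller system onto `𝔽₄`. -/
theorem bijOn_teichmullerSet (π : GR42 →+* F4) : Set.BijOn π teichmullerSet Set.univ := by
  have ha : π xi ^ 2 + π xi + 1 = 0 := by
    simpa using congrArg π xi_relation
  generalize haa : π xi = a at ha
  have h2 : (2 : F4) = 0 := CharTwo.two_eq_zero
  have a0 : a ≠ 0 := by rintro rfl; simp at ha
  have a1 : a ≠ 1 := by
    rintro rfl
    have : (1 : F4) = 0 := by linear_combination ha - h2
    exact one_ne_zero this
  have s0 : a ^ 2 ≠ 0 := pow_ne_zero 2 a0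
  have s1 : a ^ 2 ≠ 1 := fun h => a0 (by linear_combination ha - h - h2)
  have sa : a ^ 2 ≠ a := fun h => by
    have : (1 : F4) = 0 := by linear_combination ha - h - a * h2
    exact one_ne_zero this
  have hinj : Set.InjOn π teichmullerSet := by
    intro x hx y hy hxy
    simp only [teichmullerSet, Set.mem_insert_iff, Set.mem_singleton_iff] at hx hy
    rcases hx with rfl | rfl | rfl | rfl <;> rcases hy with rfl | rfl | rfl | rfl <;>
      simp only [map_zero, map_one, map_pow, haa] at hxy <;>
      first
        | rfl
        | exact absurd hxy (by first | assumption | exact Ne.symm (by assumption) | simp)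
  refine ⟨fun _ _ => Set.mem_univ _, hinj, ?_⟩
  have himg : π '' teichmullerSet = {0, 1, a, a ^ 2} := by
    simp [teichmullerSet, Set.image_insert_eq, haa]
  have hcard : (π '' teichmullerSet).ncard = 4 := by
    classical
    have hc : (({0, 1, a, a ^ 2} : Finset F4)).card = 4 := by
      rw [Finset.card_insert_of_notMem, Finset.card_insert_of_notMem, Finset.card_pair sa.symm]
      all_goals simp [a0.symm, a1.symm, s0.symm, s1.symm]
    rw [himg, ← hc, ← Set.ncard_coe_finset]
    simp
  have huniv : π '' teichmullerSet = Set.univ := by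
    refine Set.eq_of_subset_of_ncard_le (Set.subset_univ _) ?_ Set.finite_univ
    rw [hcard, Set.ncard_univ, GaloisField.card 2 2 two_ne_zero]
    norm_num
  exact huniv.ge

/-! ### The quadratic form, the ambient groups and the lifted quadric -/

/-- The quadratic form on `𝔽₄^{2ℓ}` whose first `j` pairs of consecutive coordinates `(u, w)`
contribute `α u² + u w + w²` and whose remaining `ℓ - j` pairs contribute `u w`. -/
def quadForm (ℓ j : ℕ) (α : F4) (x : Fin (2 * ℓ) → F4) : F4 :=
  ∑ i : Fin ℓ,
    if (i : ℕ) < j then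
      α * x ⟨2 * i, by omega⟩ ^ 2 + x ⟨2 * i, by omega⟩ * x ⟨2 * i + 1, by omega⟩
        + x ⟨2 * i + 1, by omega⟩ ^ 2
    else x ⟨2 * i, by omega⟩ * x ⟨2 * i + 1, by omega⟩

/-- The additive group `GR(4,2)^k × 𝔽₄^{2ℓ - 2k}`. -/
abbrev LiftedSpace (ℓ k : ℕ) : Type :=
  (Fin k → GR42) × (Fin (2 * ℓ - 2 * k) → F4)

/-- The group `ℤ₄^{2k} × ℤ₂^{4ℓ - 4k}`. -/
abbrev TargetGroup (ℓ k : ℕ) : Type :=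
  (Fin (2 * k) → ZMod 4) × (Fin (4 * ℓ - 4 * k) → ZMod 2)

/-- The bijection `F_k`: the first `k` pairs of consecutive coordinates `(u, w)` are sent to
`π⁻¹(u) + 2 π⁻¹(w)`, with `π⁻¹` the Teichmüller lift, and the other coordinates are kept. -/
def liftMap (ℓ k : ℕ) (hk : k ≤ ℓ) (π : GR42 →+* F4) (x : Fin (2 * ℓ) → F4) :
    LiftedSpace ℓ k :=
  (fun i => teichmullerLift π (x ⟨2 * i, by omega⟩)
      + 2 * teichmullerLift π (x ⟨2 * i + 1, by omega⟩),
    fun i => x ⟨2 * k + i, by omega⟩)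

/-- The set `D_{ℓ,j,k}`: the image under `F_k` of the nonzero zeros of `Q_{ℓ,j}`. -/
def liftedQuadric (ℓ j k : ℕ) (hk : k ≤ ℓ) (α : F4) (π : GR42 →+* F4) :
    Set (LiftedSpace ℓ k) :=
  liftMap ℓ k hk π '' {x | x ≠ 0 ∧ quadForm ℓ j α x = 0}

end GaloisRingPDS

end

/-! Transport the group law through `F_k`. Since T(x) + T(y) = T(x+y) + 2T(x²y²) for Teichmüller
lifts T, the first k pairs add by (u,w) + (u',w') = (u+u', w+w'+u²u'²), and the other pairs add as
usual. It remains to count the zero set Z of Q and its intersections with translates;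
`isPDS_of_card_inter` turns these counts into parameters.

Let χ be the ±1 trace character. Then 16·#{y : Q(y) = Q(y+z) = 0} is the sum of χ(cQ(y+z) + dQ(y))
over c, d and y, and for fixed c, d it factors over pairs of coordinates. A block contributes
±4·χ(cd(c+d)²q(z)) if c ≠ d (`blockSum_of_ne`), and 0 if c = d ≠ 0 and its part of z is nonzero
(`blockSum_self_of_ne`). The sign is - for αu²+uw+w², + for uw. These values are unaffected by the
carry u²u'² in an elliptic block, so k ≤ j gives the counts of an ordinary quadric with sign (-1)^j
(`ncard_familyForm_eq_zero`, `ncard_familyForm_translate`). -/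

noncomputable section

namespace GaloisRingPDS

/-! ### A computable model of the field with four elements -/

/-- Addition of `𝔽₄` in the basis `1, α` over `𝔽₂`. -/
def coordAdd (x y : Bool × Bool) : Bool × Bool := (xor x.1 y.1, xor x.2 y.2)

/-- Multiplication of `𝔽₄` in the basis `1, α` over `𝔽₂`. -/
def coordMul (x y : Bool × Bool) : Bool × Bool :=
  (xor (x.1 && y.1) (x.2 && y.2), xor (xor (x.1 && y.2) (x.2 && y.1)) (x.2 && y.2))

/-- The additive character of `𝔽₄` given by the trace, in coordinates. -/
def coordSign (x : Bool × Bool) : ℤ := bif x.2 then -1 else 1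

/-- The element of `𝔽₄` with the given coordinates in the basis `1, α`. -/
def ofCoord (α : F4) (x : Bool × Bool) : F4 := (bif x.1 then 1 else 0) + bif x.2 then α else 0

theorem two_eq_zero_F4 : (2 : F4) = 0 := CharTwo.two_eq_zero

theorem ofCoord_add (α : F4) (x y : Bool × Bool) :
    ofCoord α x + ofCoord α y = ofCoord α (coordAdd x y) := by
  have h2 := two_eq_zero_F4
  obtain ⟨a, b⟩ := x
  obtain ⟨c, d⟩ := y
  cases a <;> cases b <;> cases c <;> cases d <;> simp [ofCoord, coordAdd] <;> grind

theorem ofCoord_mul {α : F4} (hα : α ^ 2 = α + 1) (x y : Bool × Bool) :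
    ofCoord α x * ofCoord α y = ofCoord α (coordMul x y) := by
  have h2 := two_eq_zero_F4
  obtain ⟨a, b⟩ := x
  obtain ⟨c, d⟩ := y
  cases a <;> cases b <;> cases c <;> cases d <;> simp [ofCoord, coordMul] <;> grind

theorem ofCoord_false (α : F4) : ofCoord α (false, false) = 0 := by simp [ofCoord]

theorem ofCoord_bijective {α : F4} (hα : α ^ 2 = α + 1) : Function.Bijective (ofCoord α) := by
  have h2 := two_eq_zero_F4
  have h1 : (1 : F4) ≠ 0 := one_ne_zero
  have : Fintype F4 := Fintype.ofFinite _
  rw [Fintype.bijective_iff_injective_and_card]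
  constructor
  · rintro ⟨a, b⟩ ⟨c, d⟩ h
    cases a <;> cases b <;> cases c <;> cases d <;> simp [ofCoord] at h ⊢ <;> grind
  · rw [← Nat.card_eq_fintype_card (α := F4), GaloisField.card 2 2 two_ne_zero]
    rfl

/-- The coordinates with respect to the basis `1, α` as a bijection. -/
def coordEquiv {α : F4} (hα : α ^ 2 = α + 1) : Bool × Bool ≃ F4 :=
  Equiv.ofBijective _ (ofCoord_bijective hα)

instance : Fintype F4 := Fintype.ofFinite _

open Classical in
/-- The additive character of `𝔽₄` given by the trace. -/
def traceSign (x : F4) : ℤ := if x ^ 2 = x then 1 else -1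

theorem traceSign_ofCoord {α : F4} (hα : α ^ 2 = α + 1) (x : Bool × Bool) :
    traceSign (ofCoord α x) = coordSign x := by
  have h2 := two_eq_zero_F4
  have h1 : (1 : F4) ≠ 0 := one_ne_zero
  obtain ⟨a, b⟩ := x
  rw [traceSign]
  cases a <;> cases b <;> simp [ofCoord, coordSign] <;> grind

theorem traceSign_zero : traceSign 0 = 1 := by simp [traceSign]

theorem traceSign_add {α : F4} (hα : α ^ 2 = α + 1) (x y : F4) :
    traceSign (x + y) = traceSign x * traceSign y := by
  obtain ⟨x, rfl⟩ := (ofCoord_bijective hα).surjective x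
  obtain ⟨y, rfl⟩ := (ofCoord_bijective hα).surjective y
  rw [ofCoord_add, traceSign_ofCoord hα, traceSign_ofCoord hα, traceSign_ofCoord hα]
  revert x y
  decide

theorem traceSign_sum {α : F4} (hα : α ^ 2 = α + 1) {ι : Type*} (s : Finset ι) (g : ι → F4) :
    traceSign (∑ i ∈ s, g i) = ∏ i ∈ s, traceSign (g i) := by
  classical
  induction s using Finset.induction_on with
  | empty => simp [traceSign_zero]
  | insert a s ha ih => rw [Finset.sum_insert ha, Finset.prod_insert ha, traceSign_add hα, ih]

/-- Summing a function over `𝔽₄` in coordinates. -/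
theorem sum_F4 {α : F4} (hα : α ^ 2 = α + 1) (h : F4 → ℤ) :
    ∑ x, h x = ∑ x, h (ofCoord α x) :=
  (Equiv.sum_comp (coordEquiv hα) h).symm

-- Character orthogonality, used to detect the zeros of the form.
open Classical in
theorem sum_traceSign_mul {α : F4} (hα : α ^ 2 = α + 1) (q : F4) :
    ∑ c, traceSign (c * q) = if q = 0 then 4 else 0 := by
  obtain ⟨q, rfl⟩ := (ofCoord_bijective hα).surjective q
  rw [sum_F4 hα]
  simp only [ofCoord_mul hα, traceSign_ofCoord hα]
  rw [← ofCoord_false α, (ofCoord_bijective hα).injective.eq_iff]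
  convert (by decide : ∀ q : Bool × Bool,
    ∑ c, coordSign (coordMul c q) = if q = (false, false) then 4 else 0) q

/-! ### Binary blocks -/

/-- The binary form `α u² + u w + w²` (`β = true`) or `u w` (`β = false`). -/
def blockForm (α : F4) (β : Bool) (p : F4 × F4) : F4 :=
  (bif β then α * p.1 ^ 2 + p.2 ^ 2 else 0) + p.1 * p.2

/-- The addition of `GR(4,2)` in Teichmüller coordinates (`τ = true`) or that of `𝔽₄²`
(`τ = false`). -/
def blockAdd (τ : Bool) (p q : F4 × F4) : F4 × F4 :=
  (p.1 + q.1, p.2 + q.2 + bif τ then p.1 ^ 2 * q.1 ^ 2 else 0)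

/-- The type of the quadratic form of a block. -/
def blockSign (β : Bool) : ℤ := bif β then -1 else 1

/-- `blockForm` in coordinates. -/
def coordForm (β : Bool) (u w : Bool × Bool) : Bool × Bool :=
  coordAdd (bif β then coordAdd (coordMul (false, true) (coordMul u u)) (coordMul w w)
    else (false, false)) (coordMul u w)

/-- The summand of the exponential sum of a block, in coordinates. -/
def coordTerm (β τ : Bool) (c d u w u' w' : Bool × Bool) : ℤ :=
  coordSign (coordAdd (coordMul c (coordForm β (coordAdd u u') (coordAdd (coordAdd w w')
    (bif τ then coordMul (coordMul u u) (coordMul u' u') else (false, false)))))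
    (coordMul d (coordForm β u w)))

/-- Without carry, complete the square: cq(p+z) + dq(p) = (c+d)q(p + cz/(c+d)) + (cd/(c+d))q(z),
with 1/(c+d) = (c+d)². In an elliptic block the carry changes q(p+z) only when u = u' ≠ 0, by u². On
that fibre the sum over w vanishes unless du = (c+d)², and then cu² = cd(c+d) is 0 or 1, of trace 0.
The finite check is left to the kernel. -/
theorem coord_sum_ne : ∀ β τ : Bool, (τ → β) → ∀ c d : Bool × Bool, c ≠ d →
    ∀ u' w' : Bool × Bool, ∑ u, ∑ w, coordTerm β τ c d u w u' w' =
      blockSign β * 4 * coordSign (coordMul (coordMul (coordMul c d)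
        (coordMul (coordAdd c d) (coordAdd c d))) (coordForm β u' w')) := by
  decide +kernel

/-- Without carry the exponent is affine in p, with nonzero linear part because the polar form is
nondegenerate. The carry only adds a constant on the fibre u = u' ≠ 0, where the sum over w is
already zero. -/
theorem coord_sum_eq : ∀ β τ : Bool, (τ → β) → ∀ c : Bool × Bool, c ≠ (false, false) →
    ∀ u' w' : Bool × Bool, ¬ (u' = (false, false) ∧ w' = (false, false)) →
    ∑ u, ∑ w, coordTerm β τ c c u w u' w' = 0 := by
  decide +kernel

/-! ### Partial difference sets from counting functions -/

theorem IsPDS.map {G H : Type*} [AddGroup G] [AddGroup H] (e : G ≃+ H) {D : Set G}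
    {v κ lam mu : ℤ} (h : IsPDS D v κ lam mu) : IsPDS (e '' D) v κ lam mu := by
  have key : ∀ g : G, ({p : H × H | p.1 ∈ e '' D ∧ p.2 ∈ e '' D ∧ p.1 ≠ p.2 ∧ p.1 - p.2 = e g}) =
      (fun p : G × G => (e p.1, e p.2)) ''
        {p : G × G | p.1 ∈ D ∧ p.2 ∈ D ∧ p.1 ≠ p.2 ∧ p.1 - p.2 = g} := by
    intro g
    ext ⟨a, b⟩
    obtain ⟨a, rfl⟩ := e.surjective a
    obtain ⟨b, rfl⟩ := e.surjective b
    simp only [Set.mem_ofPred_eq, Set.mem_image, Prod.mk.injEq, Prod.exists, e.injective.eq_iff,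
      exists_eq_right, ne_eq, ← map_sub]
    constructor
    · rintro ⟨h1, h2, h3, h4⟩
      exact ⟨a, b, ⟨h1, h2, h3, h4⟩, rfl, rfl⟩
    · rintro ⟨a', b', ⟨h1, h2, h3, h4⟩, rfl, rfl⟩
      exact ⟨h1, h2, h3, h4⟩
  have hinj : Function.Injective (fun p : G × G => (e p.1, e p.2)) := by
    rintro ⟨a, b⟩ ⟨c, d⟩ hh
    simpa using hh
  have := h.finite
  refine ⟨Finite.of_equiv G e.toEquiv, ?_, ?_, ?_, ?_⟩
  · rw [← h.card_group, Nat.card_congr e.toEquiv]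
  · rw [← h.card_set, Set.ncard_image_of_injective _ e.injective]
  · intro g hg hgD
    obtain ⟨g, rfl⟩ := e.surjective g
    rw [key, Set.ncard_image_of_injective _ hinj]
    refine h.count_mem g (by simpa using hg) ?_
    simpa using hgD
  · intro g hg hgD
    obtain ⟨g, rfl⟩ := e.surjective g
    rw [key, Set.ncard_image_of_injective _ hinj]
    refine h.count_not_mem g (by simpa using hg) ?_
    simpa using hgD

/-- The nonzero elements of a finite symmetric set `Z` containing `0` form a partial difference
set once the intersections of `Z` with its translates have the right sizes. -/
theorem isPDS_of_card_inter {G : Type*} [AddGroup G] [Finite G] (Z : Set G) {v κ lam mu : ℤ}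
    (h0 : (0 : G) ∈ Z) (hneg : ∀ g ∈ Z, -g ∈ Z) (hv : (Nat.card G : ℤ) = v)
    (hκ : (Z.ncard : ℤ) = κ + 1)
    (hlam : ∀ g ≠ 0, g ∈ Z → ({b | b ∈ Z ∧ g + b ∈ Z}.ncard : ℤ) = lam + 2)
    (hmu : ∀ g ≠ 0, g ∉ Z → ({b | b ∈ Z ∧ g + b ∈ Z}.ncard : ℤ) = mu) :
    IsPDS (Z \ {0}) v κ lam mu := by
  -- A pair with difference g is determined by its second entry b. The values b = 0 and b = -g are
  -- the pairs involving 0; both lie in the intersection when g ∈ Z and neither does otherwise,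
  -- whence `lam + 2` against `mu`.
  have key : ∀ g : G, g ≠ 0 →
      {p : G × G | p.1 ∈ Z \ {0} ∧ p.2 ∈ Z \ {0} ∧ p.1 ≠ p.2 ∧ p.1 - p.2 = g} =
        (fun b => (g + b, b)) '' ({b | b ∈ Z ∧ g + b ∈ Z} \ {0, -g}) := by
    intro g hg
    ext ⟨a, b⟩
    simp only [Set.mem_ofPred_eq, Set.mem_image, Prod.mk.injEq, Set.mem_sdiff,
      Set.mem_singleton_iff, Set.mem_insert_iff, sub_eq_iff_eq_add]
    constructor
    · rintro ⟨⟨h1, h2⟩, ⟨h3, h4⟩, -, rfl⟩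
      refine ⟨b, ⟨⟨h3, h1⟩, ?_⟩, rfl, rfl⟩
      rintro (h | h)
      · exact h4 h
      · exact h2 (by rw [h, add_neg_cancel])
    · rintro ⟨b, ⟨⟨h3, h1⟩, h⟩, rfl, rfl⟩
      push Not at h
      refine ⟨⟨h1, fun hh => h.2 (neg_eq_of_add_eq_zero_right hh).symm⟩, ⟨h3, h.1⟩, ?_, rfl⟩
      simpa using hg
  have hinj : ∀ g : G, Function.Injective (fun b : G => (g + b, b)) := fun g a b h =>
    congrArg Prod.snd h
  refine ⟨inferInstance, hv, ?_, ?_, ?_⟩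
  · have := Set.ncard_sdiff_singleton_add_one h0 (Set.toFinite Z)
    push_cast [← this] at hκ
    linarith
  · rintro g hg ⟨hgZ, -⟩
    have hne : (0 : G) ≠ -g := by simpa [eq_comm] using hg
    have hsub : ({0, -g} : Set G) ⊆ {b | b ∈ Z ∧ g + b ∈ Z} := by
      rintro b (rfl | rfl)
      · exact ⟨h0, by simpa using hgZ⟩
      · exact ⟨hneg g hgZ, by simpa using h0⟩
    have h1 := Set.ncard_sdiff_add_ncard_of_subset hsub (Set.toFinite _)
    rw [Set.ncard_pair hne] at h1
    rw [key g hg, Set.ncard_image_of_injective _ (hinj g)]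
    have h2 := hlam g hg hgZ
    push_cast [← h1] at h2
    linarith
  · intro g hg hgD
    have hgZ : g ∉ Z := fun h => hgD ⟨h, hg⟩
    have hdiff : {b | b ∈ Z ∧ g + b ∈ Z} \ {0, -g} = {b | b ∈ Z ∧ g + b ∈ Z} := by
      refine sdiff_eq_left.2 ?_
      rw [Set.disjoint_right]
      rintro b (rfl | rfl) ⟨h1, h2⟩
      · exact hgZ (by simpa using h2)
      · exact hgZ (by simpa using hneg _ h1)
    rw [key g hg, Set.ncard_image_of_injective _ (hinj g), hdiff]
    exact hmu g hg hgZ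

/-! ### The Galois ring -/

theorem monic_galoisPoly : (X ^ 2 + X + 1 : (ZMod 4)[X]).Monic := by
  monicity!

theorem natDegree_galoisPoly : (X ^ 2 + X + 1 : (ZMod 4)[X]).natDegree = 2 := by
  compute_degree!

instance : Module.Free (ZMod 4) GR42 :=
  Module.Free.of_basis (AdjoinRoot.powerBasis' monic_galoisPoly).basis

instance : Module.Finite (ZMod 4) GR42 :=
  Module.Finite.of_basis (AdjoinRoot.powerBasis' monic_galoisPoly).basis

instance : Fact (1 < 4) := ⟨by norm_num⟩

theorem finrank_GR42 : Module.finrank (ZMod 4) GR42 = 2 := by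
  rw [(AdjoinRoot.powerBasis' monic_galoisPoly).finrank]
  simp [natDegree_galoisPoly]

theorem nonempty_liftedSpace_addEquiv (ℓ k : ℕ) :
    Nonempty (LiftedSpace ℓ k ≃+ TargetGroup ℓ k) := by
  have e1 : (Fin k → GR42) ≃ₗ[ZMod 4] (Fin (2 * k) → ZMod 4) := by
    refine LinearEquiv.ofFinrankEq _ _ ?_
    rw [Module.finrank_pi_fintype]
    simp [finrank_GR42, mul_comm]
  have e2 : (Fin (2 * ℓ - 2 * k) → F4) ≃ₗ[ZMod 2] (Fin (4 * ℓ - 4 * k) → ZMod 2) := by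
    refine LinearEquiv.ofFinrankEq _ _ ?_
    rw [Module.finrank_pi_fintype]
    simp [GaloisField.finrank 2 two_ne_zero]
    omega
  exact ⟨e1.toAddEquiv.prodCongr e2.toAddEquiv⟩

instance : Finite GR42 := Module.finite_of_finite (ZMod 4)

theorem card_GR42 : Nat.card GR42 = 16 := by
  have b := Module.finBasis (ZMod 4) GR42
  rw [finrank_GR42] at b
  rw [Nat.card_congr b.equivFun.toEquiv]
  simp

theorem four_eq_zero_GR42 : (4 : GR42) = 0 := by
  have h : algebraMap (ZMod 4) GR42 4 = 0 := by
    rw [show (4 : ZMod 4) = 0 by decide, map_zero]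
  rwa [map_ofNat] at h

section Teichmuller

variable (π : GR42 →+* F4)

theorem map_teichmullerLift (x : F4) : π (teichmullerLift π x) = x :=
  Function.invFunOn_eq ((bijOn_teichmullerSet π).surjOn (Set.mem_univ x))

theorem teichmullerLift_map {t : GR42} (ht : t ∈ teichmullerSet) :
    teichmullerLift π (π t) = t :=
  (bijOn_teichmullerSet π).injOn.leftInvOn_invFunOn ht

theorem teichmullerLift_mem (x : F4) : teichmullerLift π x ∈ teichmullerSet :=
  Function.invFunOn_mem ((bijOn_teichmullerSet π).surjOn (Set.mem_univ x))

theorem teichmullerSet_mul_mem {s t : GR42} (hs : s ∈ teichmullerSet) (ht : t ∈ teichmullerSet) :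
    s * t ∈ teichmullerSet := by
  have h3 : xi ^ 3 = 1 := by linear_combination (xi - 1) * xi_relation
  simp only [teichmullerSet, Set.mem_insert_iff, Set.mem_singleton_iff] at hs ht ⊢
  rcases hs with rfl | rfl | rfl | rfl <;> rcases ht with rfl | rfl | rfl | rfl <;> grind

theorem teichmullerLift_mul (x y : F4) :
    teichmullerLift π (x * y) = teichmullerLift π x * teichmullerLift π y := by
  rw [← teichmullerLift_map π (teichmullerSet_mul_mem (teichmullerLift_mem π x)
    (teichmullerLift_mem π y)), map_mul, map_teichmullerLift, map_teichmullerLift]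

/-- A sum of Teichmüller representatives, as a Teichmüller representative plus twice another. -/
theorem teichmullerSet_add {s t : GR42} (hs : s ∈ teichmullerSet) (ht : t ∈ teichmullerSet) :
    ∃ r ∈ teichmullerSet, s + t = r + 2 * (s ^ 2 * t ^ 2) := by
  have h4 := four_eq_zero_GR42
  have hx := xi_relation
  have h3 : xi ^ 3 = 1 := by linear_combination (xi - 1) * xi_relation
  suffices s + t - 2 * (s ^ 2 * t ^ 2) ∈ teichmullerSet from ⟨_, this, by ring⟩
  simp only [teichmullerSet, Set.mem_insert_iff, Set.mem_singleton_iff] at hs ht ⊢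
  rcases hs with rfl | rfl | rfl | rfl <;> rcases ht with rfl | rfl | rfl | rfl <;> grind

/-- Reduction modulo 2 identifies the representative given by `teichmullerSet_add`. The carry is the
square root of xy, which in 𝔽₄ is (xy)². -/
theorem teichmullerLift_add (x y : F4) :
    teichmullerLift π x + teichmullerLift π y =
      teichmullerLift π (x + y) + 2 * teichmullerLift π (x ^ 2 * y ^ 2) := by
  obtain ⟨r, hr, h⟩ := teichmullerSet_add (teichmullerLift_mem π x) (teichmullerLift_mem π y)
  have h2 : (2 : F4) = 0 := CharTwo.two_eq_zero
  have hπ := congrArg π h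
  simp only [map_add, map_mul, map_teichmullerLift, map_ofNat, h2, zero_mul, add_zero] at hπ
  rw [h, hπ, teichmullerLift_map π hr]
  simp only [sq, teichmullerLift_mul]

theorem two_mul_teichmullerLift_add (x y : F4) :
    2 * teichmullerLift π x + 2 * teichmullerLift π y = 2 * teichmullerLift π (x + y) := by
  linear_combination 2 * teichmullerLift_add π x y +
    teichmullerLift π (x ^ 2 * y ^ 2) * four_eq_zero_GR42

/-- The element of `GR(4,2)` with the given Teichmüller coordinates. -/
def ofTeichmuller (p : F4 × F4) : GR42 := teichmullerLift π p.1 + 2 * teichmullerLift π p.2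

theorem ofTeichmuller_add (p q : F4 × F4) : ofTeichmuller π p + ofTeichmuller π q =
    ofTeichmuller π (p.1 + q.1, p.2 + q.2 + p.1 ^ 2 * q.1 ^ 2) := by
  simp only [ofTeichmuller]
  rw [← two_mul_teichmullerLift_add, ← two_mul_teichmullerLift_add]
  linear_combination teichmullerLift_add π p.1 q.1

/-- The range is closed under addition and under multiplication by Teichmüller elements, and
contains the integers, hence every polynomial in ξ. -/
theorem ofTeichmuller_surjective : Function.Surjective (ofTeichmuller π) := by
  have hadd : ∀ x y : GR42, x ∈ Set.range (ofTeichmuller π) → y ∈ Set.range (ofTeichmuller π) →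
      x + y ∈ Set.range (ofTeichmuller π) := by
    rintro _ _ ⟨p, rfl⟩ ⟨q, rfl⟩
    exact ⟨_, (ofTeichmuller_add π p q).symm⟩
  have hmem : ∀ t ∈ teichmullerSet, t ∈ Set.range (ofTeichmuller π) := by
    intro t ht
    refine ⟨(π t, 0), ?_⟩
    have h0 : teichmullerLift π 0 = 0 := by
      simpa using teichmullerLift_map π (show (0 : GR42) ∈ teichmullerSet by simp [teichmullerSet])
    simp [ofTeichmuller, teichmullerLift_map π ht, h0]
  have hmul : ∀ t ∈ teichmullerSet, ∀ x ∈ Set.range (ofTeichmuller π),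
      t * x ∈ Set.range (ofTeichmuller π) := by
    rintro t ht _ ⟨p, rfl⟩
    refine ⟨(π t * p.1, π t * p.2), ?_⟩
    simp only [ofTeichmuller, teichmullerLift_mul, teichmullerLift_map π ht]
    ring
  have hnat : ∀ n : ℕ, (n : GR42) ∈ Set.range (ofTeichmuller π) := by
    intro n
    induction n with
    | zero => exact hmem _ (by simp [teichmullerSet])
    | succ n ih => push_cast; exact hadd _ _ ih (hmem _ (by simp [teichmullerSet]))
  have hpow : ∀ n : ℕ, xi ^ n ∈ teichmullerSet := by
    intro n
    induction n with
    | zero => simp [teichmullerSet]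
    | succ n ih => rw [pow_succ]; exact teichmullerSet_mul_mem ih (by simp [teichmullerSet])
  intro x
  change x ∈ Set.range _
  induction x using AdjoinRoot.induction_on with
  | ih p =>
    induction p using Polynomial.induction_on' with
    | add p q hp hq => rw [map_add]; exact hadd _ _ hp hq
    | monomial n a =>
      obtain ⟨m, rfl⟩ := ZMod.natCast_zmod_surjective a
      rw [← C_mul_X_pow_eq_monomial, map_mul, map_pow, AdjoinRoot.mk_X, mul_comm]
      have : AdjoinRoot.mk (X ^ 2 + X + 1 : (ZMod 4)[X]) (C (m : ZMod 4)) = (m : GR42) := by simp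
      rw [this]
      exact hmul _ (hpow n) _ (hnat m)

theorem ofTeichmuller_bijective : Function.Bijective (ofTeichmuller π) := by
  rw [Nat.bijective_iff_surjective_and_card]
  refine ⟨ofTeichmuller_surjective π, ?_⟩
  rw [Nat.card_prod, GaloisField.card 2 2 two_ne_zero, card_GR42]
  norm_num

end Teichmuller

/-! ### Exponential sums of single blocks -/

theorem blockForm_ofCoord {α : F4} (hα : α ^ 2 = α + 1) (β : Bool) (u w : Bool × Bool) :
    blockForm α β (ofCoord α u, ofCoord α w) = ofCoord α (coordForm β u w) := by
  have h : α = ofCoord α (false, true) := by simp [ofCoord]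
  cases β
  · simp [blockForm, coordForm, ofCoord_mul hα, coordAdd]
  · simp only [blockForm, coordForm, cond_true, ← ofCoord_add, ← ofCoord_mul hα, ← h]
    ring

theorem sum_block {α : F4} (hα : α ^ 2 = α + 1) (h : F4 × F4 → ℤ) :
    ∑ p, h p = ∑ u, ∑ w, h (ofCoord α u, ofCoord α w) := by
  rw [Fintype.sum_prod_type, sum_F4 hα]
  exact Finset.sum_congr rfl fun u _ => sum_F4 hα _

/-- The exponential sum attached to a block and a translation. -/
def blockSum (α : F4) (β τ : Bool) (c d : F4) (z : F4 × F4) : ℤ :=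
  ∑ p, traceSign (c * blockForm α β (blockAdd τ p z) + d * blockForm α β p)

theorem blockSum_ofCoord {α : F4} (hα : α ^ 2 = α + 1) (β τ : Bool) (c d u' w' : Bool × Bool) :
    blockSum α β τ (ofCoord α c) (ofCoord α d) (ofCoord α u', ofCoord α w') =
      ∑ u, ∑ w, coordTerm β τ c d u w u' w' := by
  rw [blockSum, sum_block hα]
  refine Finset.sum_congr rfl fun u _ => Finset.sum_congr rfl fun w _ => ?_
  have h : blockAdd τ (ofCoord α u, ofCoord α w) (ofCoord α u', ofCoord α w') =
      (ofCoord α (coordAdd u u'), ofCoord α (coordAdd (coordAdd w w')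
        (bif τ then coordMul (coordMul u u) (coordMul u' u') else (false, false)))) := by
    cases τ <;> simp [blockAdd, ← ofCoord_add, ← ofCoord_mul hα, ofCoord_false, sq]
  rw [h, blockForm_ofCoord hα, blockForm_ofCoord hα, ofCoord_mul hα, ofCoord_mul hα, ofCoord_add,
    traceSign_ofCoord hα, coordTerm]

theorem blockSum_of_ne {α : F4} (hα : α ^ 2 = α + 1) {β τ : Bool} (hτ : τ → β) {c d : F4}
    (hcd : c ≠ d) (z : F4 × F4) : blockSum α β τ c d z =
      blockSign β * 4 * traceSign (c * d * (c + d) ^ 2 * blockForm α β z) := by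
  obtain ⟨u, w⟩ := z
  obtain ⟨c, rfl⟩ := (ofCoord_bijective hα).surjective c
  obtain ⟨d, rfl⟩ := (ofCoord_bijective hα).surjective d
  obtain ⟨u, rfl⟩ := (ofCoord_bijective hα).surjective u
  obtain ⟨w, rfl⟩ := (ofCoord_bijective hα).surjective w
  rw [blockSum_ofCoord hα, coord_sum_ne β τ hτ c d (fun h => hcd (congrArg _ h)),
    blockForm_ofCoord hα, sq, ofCoord_add, ofCoord_mul hα, ofCoord_mul hα, ofCoord_mul hα,
    ofCoord_mul hα, traceSign_ofCoord hα]

theorem blockSum_self_of_ne {α : F4} (hα : α ^ 2 = α + 1) {β τ : Bool} (hτ : τ → β) {c : F4}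
    (hc : c ≠ 0) {z : F4 × F4} (hz : z ≠ 0) : blockSum α β τ c c z = 0 := by
  obtain ⟨u, w⟩ := z
  obtain ⟨c, rfl⟩ := (ofCoord_bijective hα).surjective c
  obtain ⟨u, rfl⟩ := (ofCoord_bijective hα).surjective u
  obtain ⟨w, rfl⟩ := (ofCoord_bijective hα).surjective w
  rw [blockSum_ofCoord hα]
  refine coord_sum_eq β τ hτ c (fun h => hc (by rw [h, ofCoord_false])) u w ?_
  rintro ⟨rfl, rfl⟩
  exact hz (by rw [ofCoord_false]; rfl)

theorem blockSum_zero (α : F4) (β τ : Bool) (z : F4 × F4) : blockSum α β τ 0 0 z = 16 := by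
  simp [blockSum, traceSign_zero, ← Nat.card_eq_fintype_card, GaloisField.card 2 2 two_ne_zero]

/-! ### Orthogonal sums of blocks -/

section Family

variable {ι : Type*} [Fintype ι] (β τ : ι → Bool)

/-- The quadratic form on an orthogonal sum of blocks. -/
def familyForm (α : F4) (y : ι → F4 × F4) : F4 := ∑ i, blockForm α (β i) (y i)

/-- Blockwise addition. -/
def familyAdd (y z : ι → F4 × F4) (i : ι) : F4 × F4 := blockAdd (τ i) (y i) (z i)

/-- Both the form and the addition split over blocks, so χ turns the sum into a product and the sum
over y distributes. -/
theorem sum_traceSign_family [DecidableEq ι] {α : F4} (hα : α ^ 2 = α + 1) (c d : F4)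
    (z : ι → F4 × F4) :
    ∑ y, traceSign (c * familyForm β α (familyAdd τ y z) + d * familyForm β α y) =
      ∏ i, blockSum α (β i) (τ i) c d (z i) := by
  simp only [blockSum]
  rw [Finset.prod_univ_sum, Fintype.piFinset_univ]
  refine Finset.sum_congr rfl fun y _ => ?_
  rw [familyForm, familyForm, Finset.mul_sum, Finset.mul_sum, ← Finset.sum_add_distrib,
    traceSign_sum hα]
  rfl

variable {β τ}

/-- The factor cd(c+d)² is the same for every block, so the local phases recombine into the phase of
the whole form at z. -/
theorem prod_blockSum_of_ne {α : F4} (hα : α ^ 2 = α + 1) (hτ : ∀ i, τ i → β i) {c d : F4}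
    (hcd : c ≠ d) (z : ι → F4 × F4) : ∏ i, blockSum α (β i) (τ i) c d (z i) =
      (∏ i, blockSign (β i)) * 4 ^ Fintype.card ι *
        traceSign (c * d * (c + d) ^ 2 * familyForm β α z) := by
  simp only [blockSum_of_ne hα (hτ _) hcd, Finset.prod_mul_distrib, familyForm, Finset.mul_sum,
    traceSign_sum hα, Finset.prod_const, Finset.card_univ]

theorem prod_blockSum_self_of_ne {α : F4} (hα : α ^ 2 = α + 1) (hτ : ∀ i, τ i → β i) {c : F4}
    (hc : c ≠ 0) {z : ι → F4 × F4} (hz : z ≠ 0) :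
    ∏ i, blockSum α (β i) (τ i) c c (z i) = 0 := by
  obtain ⟨i, hi⟩ := Function.ne_iff.1 hz
  exact Finset.prod_eq_zero (Finset.mem_univ i) (blockSum_self_of_ne hα (hτ i) hc hi)

theorem prod_blockSum_zero (α : F4) (z : ι → F4 × F4) :
    ∏ i, blockSum α (β i) (τ i) 0 0 (z i) = 16 ^ Fintype.card ι := by
  simp [blockSum_zero, Finset.card_univ]

theorem ncard_setOf_eq_sum {V : Type*} [Fintype V] (p : V → Prop) [DecidablePred p] :
    ({y | p y}.ncard : ℤ) = ∑ y, if p y then 1 else 0 := by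
  rw [Set.ncard_eq_toFinset_card', Finset.sum_boole]
  simp

theorem ncard_familyForm_eq_zero {α : F4} (hα : α ^ 2 = α + 1) (hτ : ∀ i, τ i → β i) :
    4 * ({y : ι → F4 × F4 | familyForm β α y = 0}.ncard : ℤ) =
      16 ^ Fintype.card ι + 3 * ((∏ i, blockSign (β i)) * 4 ^ Fintype.card ι) := by
  classical
  have h : ∀ c, ∑ y, traceSign (c * familyForm β α y) = if c = 0 then 16 ^ Fintype.card ι else
      (∏ i, blockSign (β i)) * 4 ^ Fintype.card ι := by
    intro c
    -- Coefficient 0 on the translated form removes it, leaving the plain exponential sum of the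
    -- form.
    have h1 := sum_traceSign_family β τ hα 0 c 0
    simp only [zero_mul, zero_add] at h1
    rw [h1]
    split_ifs with hc
    · rw [hc, prod_blockSum_zero]
    · rw [prod_blockSum_of_ne hα hτ (Ne.symm hc)]
      simp [traceSign_zero]
  calc 4 * ({y : ι → F4 × F4 | familyForm β α y = 0}.ncard : ℤ)
      = ∑ y, ∑ c, traceSign (c * familyForm β α y) := by
        rw [ncard_setOf_eq_sum, Finset.mul_sum]
        simp [sum_traceSign_mul hα]
    _ = ∑ c : F4, if c = 0 then (16 : ℤ) ^ Fintype.card ι else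
          (∏ i, blockSign (β i)) * 4 ^ Fintype.card ι := by
        rw [Finset.sum_comm]
        exact Finset.sum_congr rfl fun c _ => h c
    _ = _ := by
        rw [sum_F4 hα]
        simp only [← ofCoord_false α, (ofCoord_bijective hα).injective.eq_iff]
        simp [Fintype.sum_prod_type]
        ring

-- The 6 ordered pairs with cd = 0 contribute 1 each. In the other 6, c, d, c+d are the three
-- nonzero elements, with product 1, so cd(c+d)² = c+d and each nonzero value occurs twice; these
-- contribute 6 if q = 0 and -2 otherwise.
open Classical in
theorem sum_pairs_ne {α : F4} (hα : α ^ 2 = α + 1) (q : F4) :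
    ∑ c : F4, ∑ d : F4, (if c = d then 0 else traceSign (c * d * (c + d) ^ 2 * q)) =
      4 + if q = 0 then 8 else 0 := by
  obtain ⟨q, rfl⟩ := (ofCoord_bijective hα).surjective q
  rw [sum_F4 hα]
  simp only [sum_F4 hα (fun d => ite _ _ _), ofCoord_mul hα, ofCoord_add, sq,
    traceSign_ofCoord hα, (ofCoord_bijective hα).injective.eq_iff]
  rw [← ofCoord_false α]
  simp only [(ofCoord_bijective hα).injective.eq_iff]
  convert (by decide +kernel : ∀ q : Bool × Bool, ∑ c, ∑ d, (if c = d then 0 else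
    coordSign (coordMul (coordMul (coordMul c d) (coordMul (coordAdd c d) (coordAdd c d))) q)) =
      4 + if q = (false, false) then 8 else 0) q

-- As z ≠ 0, the diagonal terms c = d ≠ 0 vanish. The term c = d = 0 gives the main term, and the
-- off-diagonal ones are summed by `sum_pairs_ne`.
open Classical in
theorem ncard_familyForm_translate {α : F4} (hα : α ^ 2 = α + 1) (hτ : ∀ i, τ i → β i)
    {z : ι → F4 × F4} (hz : z ≠ 0) :
    16 * ({y | familyForm β α y = 0 ∧ familyForm β α (familyAdd τ y z) = 0}.ncard : ℤ) =
      16 ^ Fintype.card ι + (∏ i, blockSign (β i)) * 4 ^ Fintype.card ι *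
        (4 + if familyForm β α z = 0 then 8 else 0) := by
  have hcd : ∀ c d, ∏ i, blockSum α (β i) (τ i) c d (z i) =
      (if c = d then (if c = 0 then 16 ^ Fintype.card ι else 0) else 0) +
      (∏ i, blockSign (β i)) * 4 ^ Fintype.card ι *
        (if c = d then 0 else traceSign (c * d * (c + d) ^ 2 * familyForm β α z)) := by
    intro c d
    split_ifs with h h0
    · subst h h0
      rw [prod_blockSum_zero, mul_zero, add_zero]
    · subst h
      rw [prod_blockSum_self_of_ne hα hτ h0 hz, mul_zero, add_zero]
    · rw [prod_blockSum_of_ne hα hτ h, zero_add]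
  have hprod : ∀ a b : F4, ∑ c, ∑ d, traceSign (c * a + d * b) =
      (if a = 0 then 4 else 0) * (if b = 0 then 4 else 0) := by
    intro a b
    rw [← sum_traceSign_mul hα, ← sum_traceSign_mul hα, Finset.sum_mul_sum]
    simp only [traceSign_add hα]
  calc 16 * ({y | familyForm β α y = 0 ∧ familyForm β α (familyAdd τ y z) = 0}.ncard : ℤ)
      = ∑ y, ∑ c, ∑ d,
          traceSign (c * familyForm β α (familyAdd τ y z) + d * familyForm β α y) := by
        rw [ncard_setOf_eq_sum, Finset.mul_sum]
        refine Finset.sum_congr rfl fun y _ => ?_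
        rw [hprod]
        split_ifs <;> simp_all
    _ = ∑ c, ∑ d, ∏ i, blockSum α (β i) (τ i) c d (z i) := by
        rw [Finset.sum_comm]
        refine Finset.sum_congr rfl fun c _ => ?_
        rw [Finset.sum_comm]
        exact Finset.sum_congr rfl fun d _ => sum_traceSign_family β τ hα c d z
    _ = _ := by
        simp only [hcd, Finset.sum_add_distrib, ← Finset.mul_sum, sum_pairs_ne hα]
        simp

/-- The blockwise opposite. -/
def familyNeg {ι : Type*} (τ : ι → Bool) (z : ι → F4 × F4) (i : ι) : F4 × F4 :=
  ((z i).1, (z i).2 + bif τ i then (z i).1 else 0)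

/-- The carry of u with itself is u⁴ = u, which cancels the u added to the second coordinate. -/
theorem familyNeg_add {ι : Type*} (τ : ι → Bool) (z : ι → F4 × F4) : familyAdd τ (familyNeg τ z) z = 0 := by
  have h2 := two_eq_zero_F4
  have h4 : ∀ x : F4, x ^ 4 = x := by
    intro x
    have := FiniteField.pow_card x
    rwa [← Nat.card_eq_fintype_card, GaloisField.card 2 2 two_ne_zero] at this
  funext i
  have hz := h4 (z i).1
  refine Prod.ext ?_ ?_
  · simp only [familyNeg, familyAdd, blockAdd, Pi.zero_apply, Prod.fst_zero]
    linear_combination (z i).1 * h2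
  · cases hi : τ i <;>
      simp only [familyNeg, familyAdd, blockAdd, hi, Pi.zero_apply, Prod.snd_zero, cond_true,
        cond_false]
    · linear_combination (z i).2 * h2
    · linear_combination ((z i).2 + (z i).1) * h2 + hz

/-- In characteristic 2, αu²+uw+w² is invariant under w ↦ w+u, whereas uw is not; hence carries are
allowed only in elliptic blocks. -/
theorem familyForm_neg (α : F4) (hτ : ∀ i, τ i → β i) (z : ι → F4 × F4) :
    familyForm β α (familyNeg τ z) = familyForm β α z := by
  have h2 := two_eq_zero_F4
  refine Finset.sum_congr rfl fun i _ => ?_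
  have := hτ i
  cases hi : τ i
  · simp [familyNeg, blockForm, hi]
  · rw [hi] at this
    simp only [familyNeg, blockForm, hi, this rfl, cond_true]
    linear_combination ((z i).1 ^ 2 + (z i).1 * (z i).2) * h2

end Family

/-! ### The lifted quadric -/

section Lift

variable (ℓ j k : ℕ)

/-- The pairs of consecutive coordinates. -/
def pairEquiv : (Fin (2 * ℓ) → F4) ≃ (Fin ℓ → F4 × F4) where
  toFun x i := (x ⟨2 * i, by omega⟩, x ⟨2 * i + 1, by omega⟩)
  invFun y m := if (m : ℕ) % 2 = 0 then (y ⟨m / 2, by omega⟩).1 else (y ⟨m / 2, by omega⟩).2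
  left_inv x := by
    funext m
    dsimp only
    split_ifs with h <;> refine congrArg x (Fin.ext ?_) <;> dsimp only <;> omega
  right_inv y := by
    funext i
    ext
    · simp
    · have : (2 * (i : ℕ) + 1) / 2 = i := by omega
      simp [this, Nat.add_mod]

theorem quadForm_eq_familyForm (α : F4) (x : Fin (2 * ℓ) → F4) :
    quadForm ℓ j α x = familyForm (fun i : Fin ℓ => decide ((i : ℕ) < j)) α (pairEquiv ℓ x) := by
  refine Finset.sum_congr rfl fun i _ => ?_
  by_cases h : (i : ℕ) < j
  · simp [blockForm, pairEquiv, h]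
    ring
  · simp [blockForm, pairEquiv, h]

variable {ℓ k} (hk : k ≤ ℓ) (π : GR42 →+* F4)

theorem liftMap_add (x y z : Fin (2 * ℓ) → F4)
    (h : pairEquiv ℓ z = familyAdd (fun i : Fin ℓ => decide ((i : ℕ) < k)) (pairEquiv ℓ x)
      (pairEquiv ℓ y)) :
    liftMap ℓ k hk π z = liftMap ℓ k hk π x + liftMap ℓ k hk π y := by
  refine Prod.ext (funext fun i => ?_) (funext fun i => ?_)
  · have hi := congrFun h ⟨i, by omega⟩
    change ofTeichmuller π (pairEquiv ℓ z ⟨i, by omega⟩) =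
      ofTeichmuller π (pairEquiv ℓ x ⟨i, by omega⟩) + ofTeichmuller π (pairEquiv ℓ y ⟨i, by omega⟩)
    rw [ofTeichmuller_add, hi]
    simp [familyAdd, blockAdd]
  -- Coordinate 2k+i belongs to pair k + ⌊i/2⌋, which has no carry; the parity of i selects the
  -- entry.
  · have hi := congrFun h ⟨k + i / 2, by omega⟩
    simp only [familyAdd, blockAdd, pairEquiv, Equiv.coe_fn_mk, Prod.mk.injEq] at hi
    simp only [liftMap, Prod.snd_add, Pi.add_apply]
    rcases Nat.even_or_odd' (i : ℕ) with ⟨m, hm | hm⟩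
    · have e : 2 * (k + (i : ℕ) / 2) = 2 * k + i := by omega
      simpa [e] using hi.1
    · have e : 2 * (k + (i : ℕ) / 2) + 1 = 2 * k + i := by omega
      simpa [e] using hi.2

theorem liftMap_bijective : Function.Bijective (liftMap ℓ k hk π) := by
  rw [Nat.bijective_iff_injective_and_card]
  constructor
  · intro x y h
    have h1 := congrArg Prod.fst h
    have h2 := congrArg Prod.snd h
    funext m
    by_cases hm : (m : ℕ) < 2 * k
    · have h3 := (ofTeichmuller_bijective π).injective
        (show ofTeichmuller π (x ⟨2 * (m / 2), by omega⟩, x ⟨2 * (m / 2) + 1, by omega⟩) =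
          ofTeichmuller π (y ⟨2 * (m / 2), by omega⟩, y ⟨2 * (m / 2) + 1, by omega⟩) from
          congrFun h1 ⟨m / 2, by omega⟩)
      rw [Prod.mk.injEq] at h3
      rcases Nat.even_or_odd' (m : ℕ) with ⟨n, hn | hn⟩
      · have e : 2 * ((m : ℕ) / 2) = m := by omega
        simpa [e] using h3.1
      · have e : 2 * ((m : ℕ) / 2) + 1 = m := by omega
        simpa [e] using h3.2
    · have h3 := congrFun h2 ⟨m - 2 * k, by omega⟩
      have e : 2 * k + ((m : ℕ) - 2 * k) = m := by omega
      simpa [liftMap, e] using h3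
  · simp only [Nat.card_prod, Nat.card_fun, GaloisField.card 2 2 two_ne_zero, card_GR42,
      Nat.card_fin]
    rw [show 16 = (2 ^ 2) ^ 2 by norm_num, ← pow_mul (2 ^ 2), ← pow_add]
    congr 1
    omega

theorem liftMap_zero : liftMap ℓ k hk π 0 = 0 := by
  -- Zero is idempotent for the blockwise addition, so its image equals its own double.
  have h : pairEquiv ℓ 0 = familyAdd (fun i : Fin ℓ => decide ((i : ℕ) < k)) (pairEquiv ℓ 0)
      (pairEquiv ℓ 0) := by
    funext i
    simp [pairEquiv, familyAdd, blockAdd]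
  simpa using liftMap_add hk π 0 0 0 h

theorem liftedQuadric_eq (α : F4) : liftedQuadric ℓ j k hk α π =
    liftMap ℓ k hk π '' {x | quadForm ℓ j α x = 0} \ {0} := by
  rw [← liftMap_zero hk π, ← Set.image_singleton, ← Set.image_sdiff (liftMap_bijective hk π).1]
  rw [liftedQuadric]
  congr 1
  ext x
  simp [and_comm]

theorem prod_blockSign (hj : j ≤ ℓ) :
    ∏ i : Fin ℓ, blockSign (decide ((i : ℕ) < j)) = (-1) ^ j := by
  obtain ⟨m, rfl⟩ := Nat.exists_eq_add_of_le hj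
  rw [Fin.prod_univ_add]
  simp [blockSign]

variable {j}

/-- Both parities are treated at once through the sign (-1)^j. -/
theorem isPDS_liftedQuadric (hkj : k ≤ j) (hj : j ≤ ℓ) (hℓ : 1 ≤ ℓ) {α : F4}
    (hα : α ^ 2 = α + 1) : IsPDS (liftedQuadric ℓ j k hk α π) (4 ^ (2 * ℓ))
      (4 * 4 ^ (2 * ℓ - 2) + 3 * (-1) ^ j * 4 ^ (ℓ - 1) - 1)
      (4 ^ (2 * ℓ - 2) + 3 * (-1) ^ j * 4 ^ (ℓ - 1) - 2)
      (4 ^ (2 * ℓ - 2) + (-1) ^ j * 4 ^ (ℓ - 1)) := by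
  obtain ⟨m, rfl⟩ := Nat.exists_eq_add_of_le' hℓ
  -- Here k ≤ j enters: every block with a carry is elliptic.
  have hτ : ∀ i : Fin (m + 1), decide ((i : ℕ) < k) → decide ((i : ℕ) < j) := by
    intro i
    simpa using fun h => lt_of_lt_of_le h hkj
  have hF := liftMap_bijective hk π
  set F := liftMap (m + 1) k hk π with hFdef
  have hadd : ∀ y z, F ((pairEquiv _).symm y) + F ((pairEquiv _).symm z) =
      F ((pairEquiv _).symm (familyAdd (fun i : Fin (m + 1) => decide ((i : ℕ) < k)) y z)) := by
    intro y z
    rw [hFdef, ← liftMap_add]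
    simp
  have hG : ∀ g, ∃ z, F ((pairEquiv _).symm z) = g := by
    intro g
    obtain ⟨x, rfl⟩ := hF.surjective g
    exact ⟨pairEquiv _ x, by simp⟩
  have hinj : Function.Injective fun y => F ((pairEquiv (m + 1)).symm y) :=
    hF.injective.comp (Equiv.injective _)
  have hmem : ∀ y, F ((pairEquiv _).symm y) ∈ F '' {x | quadForm (m + 1) j α x = 0} ↔
      familyForm (fun i : Fin (m + 1) => decide ((i : ℕ) < j)) α y = 0 := by
    intro y
    rw [hF.injective.mem_set_image, Set.mem_ofPred_eq, quadForm_eq_familyForm,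
      Equiv.apply_symm_apply]
  have hzero : F ((pairEquiv _).symm 0) = 0 := by
    rw [← liftMap_zero hk π]
    congr 1
    rw [Equiv.symm_apply_eq]
    rfl
  have hq : (16 : ℤ) ^ (m + 1) = 16 * 4 ^ (2 * (m + 1) - 2) := by
    rw [show 2 * (m + 1) - 2 = 2 * m by omega, pow_mul, pow_succ]
    norm_num [mul_comm]
  have hcount : ∀ z : Fin (m + 1) → F4 × F4,
      {b | b ∈ F '' {x | quadForm (m + 1) j α x = 0} ∧
        F ((pairEquiv _).symm z) + b ∈ F '' {x | quadForm (m + 1) j α x = 0}}.ncard =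
      {y | familyForm (fun i : Fin (m + 1) => decide ((i : ℕ) < j)) α y = 0 ∧
        familyForm (fun i : Fin (m + 1) => decide ((i : ℕ) < j)) α
          (familyAdd (fun i : Fin (m + 1) => decide ((i : ℕ) < k)) y z) = 0}.ncard := by
    intro z
    rw [← Set.ncard_image_of_injective _ hinj]
    congr 1
    ext b
    obtain ⟨y, rfl⟩ := hG b
    rw [hinj.mem_set_image, Set.mem_ofPred_eq, Set.mem_ofPred_eq,
      add_comm (F ((pairEquiv _).symm z)), hadd, hmem, hmem]
  rw [liftedQuadric_eq]
  refine isPDS_of_card_inter _ ?_ ?_ ?_ ?_ ?_ ?_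
  · rw [← hzero, hmem]
    simp [familyForm, blockForm]
  · intro g hg
    obtain ⟨z, rfl⟩ := hG g
    have h := hadd (familyNeg (fun i : Fin (m + 1) => decide ((i : ℕ) < k)) z) z
    rw [familyNeg_add, hzero, add_eq_zero_iff_eq_neg] at h
    rw [← h, hmem, familyForm_neg α hτ]
    rwa [hmem] at hg
  · rw [← Nat.card_congr (Equiv.ofBijective _ hF), Nat.card_fun, Nat.card_fin,
      GaloisField.card 2 2 two_ne_zero]
    norm_num
  · have h := ncard_familyForm_eq_zero hα hτ
    rw [prod_blockSign j hj, Fintype.card_fin, hq, pow_succ 4 m] at h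
    have e : F '' {x | quadForm (m + 1) j α x = 0} = (fun y => F ((pairEquiv (m + 1)).symm y)) ''
        {y | familyForm (fun i : Fin (m + 1) => decide ((i : ℕ) < j)) α y = 0} := by
      ext b
      obtain ⟨y, rfl⟩ := hG b
      rw [hinj.mem_set_image, hmem, Set.mem_ofPred_eq]
    rw [e, Set.ncard_image_of_injective _ hinj, Nat.add_sub_cancel]
    linarith
  · intro g hg hgZ
    obtain ⟨z, rfl⟩ := hG g
    have hz : z ≠ 0 := by
      rintro rfl
      exact hg hzero
    have h := ncard_familyForm_translate hα hτ hz
    rw [hmem] at hgZ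
    rw [prod_blockSign j hj, Fintype.card_fin, hq, pow_succ 4 m, if_pos hgZ] at h
    rw [hcount, Nat.add_sub_cancel]
    linarith
  · intro g hg hgZ
    obtain ⟨z, rfl⟩ := hG g
    have hz : z ≠ 0 := by
      rintro rfl
      exact hg hzero
    have h := ncard_familyForm_translate hα hτ hz
    rw [hmem] at hgZ
    rw [prod_blockSign j hj, Fintype.card_fin, hq, pow_succ 4 m, if_neg hgZ] at h
    rw [hcount, Nat.add_sub_cancel]
    linarith

end Lift

end GaloisRingPDS

end

theorem theorem2p1 (ℓ j k : ℕ) (hk : 1 ≤ k) (hkj : k ≤ j) (hjℓ : j ≤ ℓ)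
    (α : GaloisRingPDS.F4) (hα : α ^ 2 = α + 1)
    (π : GaloisRingPDS.GR42 →+* GaloisRingPDS.F4) (hπ : Function.Surjective π) :
    Nonempty (GaloisRingPDS.LiftedSpace ℓ k ≃+ GaloisRingPDS.TargetGroup ℓ k) ∧
    (Odd j →
      GaloisRingPDS.IsNegativeLatinSquareTypePDS
        (GaloisRingPDS.liftedQuadric ℓ j k (hkj.trans hjℓ) α π)
        (4 ^ (2 * ℓ)) ((4 ^ ℓ + 1) * (4 ^ (ℓ - 1) - 1))
        (4 ^ (2 * ℓ - 2) - 3 * 4 ^ (ℓ - 1) - 2) (4 ^ (2 * ℓ - 2) - 4 ^ (ℓ - 1)) ∧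
      ∀ e : GaloisRingPDS.LiftedSpace ℓ k ≃+ GaloisRingPDS.TargetGroup ℓ k,
        GaloisRingPDS.IsNegativeLatinSquareTypePDS
          (e '' GaloisRingPDS.liftedQuadric ℓ j k (hkj.trans hjℓ) α π)
          (4 ^ (2 * ℓ)) ((4 ^ ℓ + 1) * (4 ^ (ℓ - 1) - 1))
          (4 ^ (2 * ℓ - 2) - 3 * 4 ^ (ℓ - 1) - 2) (4 ^ (2 * ℓ - 2) - 4 ^ (ℓ - 1))) ∧
    (Even j →
      GaloisRingPDS.IsLatinSquareTypePDS
        (GaloisRingPDS.liftedQuadric ℓ j k (hkj.trans hjℓ) α π)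
        (4 ^ (2 * ℓ)) ((4 ^ ℓ - 1) * (4 ^ (ℓ - 1) + 1))
        (4 ^ (2 * ℓ - 2) + 3 * 4 ^ (ℓ - 1) - 2) (4 ^ (2 * ℓ - 2) + 4 ^ (ℓ - 1)) ∧
      ∀ e : GaloisRingPDS.LiftedSpace ℓ k ≃+ GaloisRingPDS.TargetGroup ℓ k,
        GaloisRingPDS.IsLatinSquareTypePDS
          (e '' GaloisRingPDS.liftedQuadric ℓ j k (hkj.trans hjℓ) α π)
          (4 ^ (2 * ℓ)) ((4 ^ ℓ - 1) * (4 ^ (ℓ - 1) + 1))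
          (4 ^ (2 * ℓ - 2) + 3 * 4 ^ (ℓ - 1) - 2) (4 ^ (2 * ℓ - 2) + 4 ^ (ℓ - 1))) := by
  have hℓ : 1 ≤ ℓ := hk.trans (hkj.trans hjℓ)
  have hpds := GaloisRingPDS.isPDS_liftedQuadric (hkj.trans hjℓ) π hkj hjℓ hℓ hα
  obtain ⟨m, rfl⟩ := Nat.exists_eq_add_of_le' hℓ
  have hsq : (4 : ℤ) ^ (2 * (m + 1)) = (4 ^ (m + 1)) ^ 2 := by rw [← pow_mul, mul_comm]
  have hsq' : (4 : ℤ) ^ (2 * (m + 1) - 2) = (4 ^ m) ^ 2 := by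
    rw [← pow_mul, mul_comm m]
    rfl
  refine ⟨GaloisRingPDS.nonempty_liftedSpace_addEquiv _ _, fun hj => ?_, fun hj => ?_⟩
  · have hshape : GaloisRingPDS.IsLatinSquareShape (-1) (4 ^ (2 * (m + 1)))
        ((4 ^ (m + 1) + 1) * (4 ^ (m + 1 - 1) - 1))
        (4 ^ (2 * (m + 1) - 2) - 3 * 4 ^ (m + 1 - 1) - 2)
        (4 ^ (2 * (m + 1) - 2) - 4 ^ (m + 1 - 1)) := by
      -- Here n = 4^ℓ and r = 4^(ℓ-1) - 1; the natural subtraction is not truncated since 4^m ≥ 1.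
      have hr : ((4 ^ m - 1 : ℕ) : ℤ) = 4 ^ m - 1 := by
        rw [Nat.cast_sub (Nat.one_le_pow _ _ (by norm_num))]
        simp
      refine ⟨4 ^ (m + 1), 4 ^ m - 1, ?_, ?_, ?_, ?_⟩ <;>
        simp only [hr, hsq, hsq', Nat.add_sub_cancel, Nat.cast_pow, Nat.cast_ofNat] <;> ring
    have hpds' : GaloisRingPDS.IsPDS (GaloisRingPDS.liftedQuadric (m + 1) j k (hkj.trans hjℓ) α π)
        (4 ^ (2 * (m + 1))) ((4 ^ (m + 1) + 1) * (4 ^ (m + 1 - 1) - 1))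
        (4 ^ (2 * (m + 1) - 2) - 3 * 4 ^ (m + 1 - 1) - 2)
        (4 ^ (2 * (m + 1) - 2) - 4 ^ (m + 1 - 1)) := by
      -- With ε = -1 the size 4·16^m - 3·4^m - 1 factors as (4^(m+1) + 1)(4^m - 1).
      rw [hj.neg_one_pow] at hpds
      convert hpds using 1 <;> simp only [hsq', Nat.add_sub_cancel] <;> ring
    exact ⟨⟨hpds', hshape⟩, fun e => ⟨hpds'.map e, hshape⟩⟩
  · have hshape : GaloisRingPDS.IsLatinSquareShape 1 (4 ^ (2 * (m + 1)))
        ((4 ^ (m + 1) - 1) * (4 ^ (m + 1 - 1) + 1))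
        (4 ^ (2 * (m + 1) - 2) + 3 * 4 ^ (m + 1 - 1) - 2)
        (4 ^ (2 * (m + 1) - 2) + 4 ^ (m + 1 - 1)) := by
      -- Now n = 4^ℓ and r = 4^(ℓ-1) + 1.
      refine ⟨4 ^ (m + 1), 4 ^ m + 1, ?_, ?_, ?_, ?_⟩ <;>
        simp only [hsq, hsq', Nat.add_sub_cancel, Nat.cast_pow, Nat.cast_ofNat, Nat.cast_add,
          Nat.cast_one] <;> ring
    have hpds' : GaloisRingPDS.IsPDS (GaloisRingPDS.liftedQuadric (m + 1) j k (hkj.trans hjℓ) α π)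
        (4 ^ (2 * (m + 1))) ((4 ^ (m + 1) - 1) * (4 ^ (m + 1 - 1) + 1))
        (4 ^ (2 * (m + 1) - 2) + 3 * 4 ^ (m + 1 - 1) - 2)
        (4 ^ (2 * (m + 1) - 2) + 4 ^ (m + 1 - 1)) := by
      rw [hj.neg_one_pow] at hpds
      convert hpds using 1 <;> simp only [hsq', Nat.add_sub_cancel] <;> ring
    exact ⟨⟨hpds', hshape⟩, fun e => ⟨hpds'.map e, hshape⟩⟩
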